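/- **Conventions.** All model categories are pointed, i.e. the initial object is also terminal; it is denoted $0$. $\mathrm{Ho}(\mathcal M)$ is the localization of $\mathcal M$ at its weak equivalences. An object of $\mathrm{Ho}(\mathcal M)$ is *contractible* if it is isomorphic there to $0$; an object of $\mathcal M$ is contractible if its image in $\mathrm{Ho}(\mathcal M)$ is. A *closed symmetric monoidal model category* is a model category with a closed symmetric monoidal structure such that $X\otimes(-)$ is a left Quillen functor for every cofibrant $X$, and such that for every weak equivalence $q:Q\to V$ from a cofibrant object to the monoidal unit and every cofibrant $X$ the map $q\otimes X$ is a weak equivalence. Below, $\otimes$ between objects of a homotopy category is the derived tensor product. $\mathcal M$ is *generated by* $V$ if for any two distinct parallel morphisms $h,h':X\to Y$ of $\mathrm{Ho}(\mathcal M)$ there is a morphism $f:V\to X$ in $\mathrm{Ho}(\mathcal M)$ with $h\circ f\neq h'\circ f$. $\mathcal M$ is *stable* if $\mathrm{Ho}(\mathcal M)$ is triangulated in the sense that the suspension functor, computed as $X\mapsto K X/QX$ from a functorial cofibrant replacement $QX\to X$ and functorial cofibrations $QX\to KX$ with $KX$ contractible, is an equivalence $\mathrm{Ho}(\mathcal M)\to\mathrm{Ho}(\mathcal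 M)$. Let $\mathcal M$ and $\mathcal N$ be closed symmetric monoidal model categories ($\mathcal N$ may be the category $\mathcal M$ with another such model structure), and let $V$ be the unit of $\mathcal M$. A *symmetric monoidal Bousfield bilocalization* $F:\mathcal M\to\mathcal N$ is a lax symmetric monoidal functor that preserves weak equivalences, such that its unit map $1_{\mathcal N}\to F(V)$ is a weak equivalence and the induced maps $F(X)\otimes F(Y)\to F(X\otimes Y)$ on derived tensor products are isomorphisms in $\mathrm{Ho}(\mathcal N)$, together with a fully faithful left adjoint $F_*$ and a fully faithful right adjoint $F_!$ of the functor $\mathrm{Ho}(\mathcal M)\to \mathrm{Ho}(\mathcal N)$ induced by $F$. Let $c_M:F_*(F(M))\to M$ be the counit. **Lemma 4.4 and Proposition 4.5.** Let $\mathcal M$ be generated by its unit $V$ and let $F:\mathcal M\to\mathcal N$ be a symmetric monoidal Bousfield bilocalization. 1. For every object $M$ of $\mathcal M$, $F(M)$ is contractible if and only if $F_*(F(V))\otimes M$ is contractible. 2. If moreover $\mathcal M$ is stable, then for every object $M$ of $\mathcal M$ all the maps in the zig-zag $$F_*(F(M))\longleftarrow F_*(F(V)\otimes F(M))\longrightarrow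 F_*(F(V))\otimes F_*(F(M))\xrightarrow{\ \mathrm{id}\otimes c_M\ }F_*(F(V))\otimes M$$ are isomorphisms in $\mathrm{Ho}(\mathcal M)$. In other words, they form a zig-zag of weak equivalences. Here the first map is $F_*$ applied to $F(V)\otimes F(M)\to F(V\otimes M)\cong F(M)$, and the second is adjoint to the composition $F(V)\otimes F(M)\to F(F_*F(V))\otimes F(F_*F(M))\to F(F_*F(V)\otimes F_*F(M))$ of the tensor product of the units of the adjunction and the monoidal structure map of $F$. -/

import Mathlib

open CategoryTheory Limits MonoidalCategory HomotopicalAlgebra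
open scoped ZeroObject

universe v u v₁ u₁ v₂ u₂

namespace Bilocalization

noncomputable section

/-! ### Homotopy categories -/

section Ho

variable (C : Type u) [Category.{v} C] [ModelCategory C]

/-- The homotopy category: the localization at the weak equivalences. -/
abbrev Ho : Type u := (weakEquivalences C).Localization

/-- The localization functor. -/
abbrev γ : C ⥤ Ho C := (weakEquivalences C).Q

variable {C}

lemma isIso_γ_map {X Y : C} (f : X ⟶ Y) [WeakEquivalence f] : IsIso ((γ C).map f) :=
  Localization.inverts (γ C) (weakEquivalences C) f (mem_weakEquivalences f)

/-- An object of the homotopy category is contractible if it is isomorphic there to the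
zero object of `C`. For an object `γ X`, this says that `X` is linked to the zero object
by a zig-zag of weak equivalences. -/
def IsContractible [HasZeroObject C] (X : Ho C) : Prop :=
  Nonempty (X ≅ (γ C).obj (0 : C))

/-- A class of objects `G` generates the model category `C` if it is a generator of the
homotopy category in the sense of Mac Lane: for any two distinct parallel morphisms
`h, h' : X ⟶ Y` there are `S` in `G` and a morphism `f : S ⟶ X` such that `f ≫ h ≠ f ≫ h'`. -/
def Generates (G : Set C) : Prop :=
  ∀ ⦃X Y : Ho C⦄ (h h' : X ⟶ Y), h ≠ h' →
    ∃ S ∈ G, ∃ f : (γ C).obj S ⟶ X, f ≫ h ≠ f ≫ h'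

variable (C) in
/-- A functorial model of the suspension: `Q X` is a cofibrant replacement of `X`, `Q X ⟶ K X` is
a cofibration to a contractible object (a cone), and `S X` is the quotient `K X / Q X`. In
particular `S X` is the homotopy pushout of `0 ← X → 0`. -/
structure SuspensionModel [HasZeroObject C] where
  /-- the cofibrant replacement -/
  Q : C ⥤ C
  /-- the cone -/
  K : C ⥤ C
  /-- the suspension -/
  S : C ⥤ C
  /-- the augmentation of the cofibrant replacement -/
  p : Q ⟶ 𝟭 C
  /-- the inclusion in the cone -/
  i : Q ⟶ K
  /-- the projection of the cone on the suspension -/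
  q : K ⟶ S
  isCofibrant (X : C) : IsCofibrant (Q.obj X)
  weakEquivalence_p (X : C) : WeakEquivalence (p.app X)
  cofibration_i (X : C) : Cofibration (i.app X)
  weakEquivalence_cone (X : C) : WeakEquivalence ((isZero_zero C).from_ (K.obj X))
  isPushout (X : C) :
    IsPushout (i.app X) ((isZero_zero C).from_ (Q.obj X)) (q.app X) ((isZero_zero C).to_ (S.obj X))

variable (C) in
/-- A pointed model category is stable if the suspension functor of its homotopy category is an
equivalence, that is, if its homotopy category is triangulated. -/
def IsStable [HasZeroObject C] : Prop :=
  ∃ (D : SuspensionModel C) (E : Ho C ≌ Ho C), Nonempty (D.S ⋙ γ C ≅ γ C ⋙ E.functor)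

end Ho

/-! ### Monoidal model categories and the derived tensor product -/

/-- Closed symmetric monoidal model categories: tensoring with a cofibrant object is a left Quillen
functor (it is a left adjoint because `C` is closed), and the unit axiom holds. By symmetry the
same is true for tensoring on the other side. The first two axioms follow from the pushout-product
axiom, and also from the condition that tensoring with any object is left Quillen. -/
class MonoidalModelCategory (C : Type u) [Category.{v} C] [ModelCategory C] [MonoidalCategory C]
    [SymmetricCategory C] [MonoidalClosed C] : Prop where
  cofibration_whiskerLeft (X : C) [IsCofibrant X] {A B : C} (f : A ⟶ B) [Cofibration f] :
    Cofibration (X ◁ f)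
  weakEquivalence_whiskerLeft (X : C) [IsCofibrant X] {A B : C} (f : A ⟶ B) [Cofibration f]
    [WeakEquivalence f] : WeakEquivalence (X ◁ f)
  weakEquivalence_whiskerRight_unit {Q : C} (q : Q ⟶ 𝟙_ C) [IsCofibrant Q] [WeakEquivalence q]
    (X : C) [IsCofibrant X] : WeakEquivalence (q ▷ X)

section Tensor

variable (C : Type u) [Category.{v} C] [ModelCategory C] [MonoidalCategory C]

/-- The localization functor restricted to cofibrant objects. -/
abbrev γc : CofibrantObject C ⥤ Ho C := CofibrantObject.ι ⋙ γ C

/-- The bifunctor sending cofibrant objects `X` and `Y` to `X ⊗ Y` in the homotopy category. -/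
abbrev cofibrantTensor : CofibrantObject C ⥤ CofibrantObject C ⥤ Ho C :=
  (((Functor.whiskeringLeft₂ (Ho C)).obj CofibrantObject.ι).obj CofibrantObject.ι).obj
    (curriedTensor C ⋙ (Functor.whiskeringRight _ _ _).obj (γ C))

variable [SymmetricCategory C] [MonoidalClosed C] [MonoidalModelCategory C]

variable {C} in
lemma weakEquivalence_whiskerLeft_of_isCofibrant (X : C) [IsCofibrant X] {A B : C} (f : A ⟶ B)
    [IsCofibrant A] [IsCofibrant B] [WeakEquivalence f] : WeakEquivalence (X ◁ f) := by
  let h : CofibrantBrownFactorization f := Classical.arbitrary _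
  have : Cofibration h.i := (cofibration_iff _).2 h.hi
  have := MonoidalModelCategory.weakEquivalence_whiskerLeft X h.i
  have := MonoidalModelCategory.weakEquivalence_whiskerLeft X h.s
  have hp : WeakEquivalence (X ◁ h.p) := by
    have h1 : X ◁ h.s ≫ X ◁ h.p = 𝟙 _ := by
      rw [← whiskerLeft_comp, h.s_p, whiskerLeft_id]
    exact weakEquivalence_of_precomp_of_fac h1
  rw [← h.fac, whiskerLeft_comp]
  infer_instance

variable {C} in
lemma weakEquivalence_whiskerRight_of_isCofibrant (X : C) [IsCofibrant X] {A B : C} (f : A ⟶ B)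
    [IsCofibrant A] [IsCofibrant B] [WeakEquivalence f] : WeakEquivalence (f ▷ X) := by
  have := weakEquivalence_whiskerLeft_of_isCofibrant X f
  have h : f ▷ X = (β_ A X).hom ≫ X ◁ f ≫ (β_ B X).inv := by
    rw [← BraidedCategory.braiding_naturality_left_assoc, Iso.hom_inv_id, Category.comp_id]
  rw [h]
  infer_instance

lemma cofibrantTensor_isInvertedBy₂ :
    MorphismProperty.IsInvertedBy₂ (weakEquivalences (CofibrantObject C))
      (weakEquivalences (CofibrantObject C)) (cofibrantTensor C) := by
  rintro ⟨X₁, X₂⟩ ⟨Y₁, Y₂⟩ ⟨f₁, f₂⟩ ⟨h₁, h₂⟩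
  have : WeakEquivalence f₁.hom := (weakEquivalence_iff _).2 h₁
  have : WeakEquivalence f₂.hom := (weakEquivalence_iff _).2 h₂
  have i₁ := weakEquivalence_whiskerRight_of_isCofibrant X₂.obj f₁.hom
  have i₂ := weakEquivalence_whiskerLeft_of_isCofibrant Y₁.obj f₂.hom
  have := isIso_γ_map (f₁.hom ▷ X₂.obj)
  have := isIso_γ_map (Y₁.obj ◁ f₂.hom)
  change IsIso ((γ C).map (f₁.hom ▷ X₂.obj) ≫ (γ C).map (Y₁.obj ◁ f₂.hom))
  infer_instance

/-- The derived tensor product: the bifunctor on the homotopy category which is induced by the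
tensor product of cofibrant objects. -/
def derivedTensor : Ho C ⥤ Ho C ⥤ Ho C :=
  Localization.lift₂ (cofibrantTensor C) (cofibrantTensor_isInvertedBy₂ C) (γc C) (γc C)

instance : Localization.Lifting₂ (γc C) (γc C) (weakEquivalences (CofibrantObject C))
    (weakEquivalences (CofibrantObject C)) (cofibrantTensor C) (derivedTensor C) :=
  inferInstanceAs (Localization.Lifting₂ _ _ _ _ _ (Localization.lift₂ _ _ _ _))

variable {C}

/-- The derived tensor product of two objects of the homotopy category. -/
abbrev tensorHo (X Y : Ho C) : Ho C := ((derivedTensor C).obj X).obj Y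

/-- The derived tensor product of two cofibrant objects is their tensor product. -/
def tensorHoIso (X Y : CofibrantObject C) :
    tensorHo ((γ C).obj X.obj) ((γ C).obj Y.obj) ≅ (γ C).obj (X.obj ⊗ Y.obj) :=
  ((Localization.Lifting₂.iso (γc C) (γc C) (weakEquivalences (CofibrantObject C))
    (weakEquivalences (CofibrantObject C)) (cofibrantTensor C) (derivedTensor C)).app X).app Y

lemma tensorHoIso_hom_naturality {X X' Y Y' : CofibrantObject C} (f : X ⟶ X') (g : Y ⟶ Y') :
    (((derivedTensor C).map ((γ C).map f.hom)).app ((γ C).obj Y.obj) ≫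
      ((derivedTensor C).obj ((γ C).obj X'.obj)).map ((γ C).map g.hom)) ≫
        (tensorHoIso X' Y').hom =
    (tensorHoIso X Y).hom ≫ (γ C).map (f.hom ⊗ₘ g.hom) := by
  let e := Localization.Lifting₂.iso (γc C) (γc C) (weakEquivalences (CofibrantObject C))
    (weakEquivalences (CofibrantObject C)) (cofibrantTensor C) (derivedTensor C)
  have h₁ : ((derivedTensor C).map ((γ C).map f.hom)).app ((γ C).obj Y.obj) ≫
      (e.hom.app X').app Y = (e.hom.app X).app Y ≫ (γ C).map (f.hom ▷ Y.obj) :=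
    NatTrans.congr_app (e.hom.naturality f) Y
  have h₂ : ((derivedTensor C).obj ((γ C).obj X'.obj)).map ((γ C).map g.hom) ≫
      (e.hom.app X').app Y' = (e.hom.app X').app Y ≫ (γ C).map (X'.obj ◁ g.hom) :=
    (e.hom.app X').naturality g
  change (_ ≫ _) ≫ (e.hom.app X').app Y' = (e.hom.app X).app Y ≫ _
  rw [MonoidalCategory.tensorHom_def, Functor.map_comp, Category.assoc, h₂, reassoc_of% h₁]

/-- The map from the tensor product of chosen cofibrant replacements, seen in the homotopy
category. -/
def resolutionTensor (X Y : C) :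
    tensorHo ((γ C).obj (CofibrantObject.HoCat.resolutionObj X))
      ((γ C).obj (CofibrantObject.HoCat.resolutionObj Y)) ⟶
    tensorHo ((γ C).obj X) ((γ C).obj Y) :=
  ((derivedTensor C).map ((γ C).map (CofibrantObject.HoCat.pResolutionObj X))).app _ ≫
    ((derivedTensor C).obj _).map ((γ C).map (CofibrantObject.HoCat.pResolutionObj Y))

instance (X Y : C) : IsIso (resolutionTensor X Y) := by
  have := isIso_γ_map (CofibrantObject.HoCat.pResolutionObj X)
  have := isIso_γ_map (CofibrantObject.HoCat.pResolutionObj Y)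
  dsimp only [resolutionTensor]
  infer_instance

lemma resolutionTensor_naturality {X X' Y Y' : C} (f : X ⟶ X') (g : Y ⟶ Y') :
    resolutionTensor X Y ≫ ((derivedTensor C).map ((γ C).map f)).app ((γ C).obj Y) ≫
      ((derivedTensor C).obj ((γ C).obj X')).map ((γ C).map g) =
    (((derivedTensor C).map ((γ C).map (CofibrantObject.HoCat.resolutionMap f))).app _ ≫
      ((derivedTensor C).obj _).map ((γ C).map (CofibrantObject.HoCat.resolutionMap g))) ≫
      resolutionTensor X' Y' := by
  dsimp only [resolutionTensor]
  simp only [Category.assoc, NatTrans.naturality_assoc]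
  simp only [← NatTrans.comp_app_assoc, ← Functor.map_comp,
    CofibrantObject.HoCat.resolutionMap_fac]

variable (C) in
/-- The canonical map from the derived tensor product of `X` and `Y` to `X ⊗ Y`. On cofibrant
replacements `X' ⟶ X` and `Y' ⟶ Y` it is induced by `X' ⊗ Y' ⟶ X ⊗ Y`. -/
def derivedTensorCounit :
    (((Functor.whiskeringLeft₂ (Ho C)).obj (γ C)).obj (γ C)).obj (derivedTensor C) ⟶
      curriedTensor C ⋙ (Functor.whiskeringRight _ _ _).obj (γ C) :=
  let φ (X Y : C) : tensorHo ((γ C).obj X) ((γ C).obj Y) ⟶ (γ C).obj (X ⊗ Y) :=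
    inv (resolutionTensor X Y) ≫
      (tensorHoIso (CofibrantObject.mk (CofibrantObject.HoCat.resolutionObj X))
        (CofibrantObject.mk (CofibrantObject.HoCat.resolutionObj Y))).hom ≫
      (γ C).map (CofibrantObject.HoCat.pResolutionObj X ⊗ₘ CofibrantObject.HoCat.pResolutionObj Y)
  have hφ {X X' Y Y' : C} (f : X ⟶ X') (g : Y ⟶ Y') :
      (((derivedTensor C).map ((γ C).map f)).app ((γ C).obj Y) ≫
        ((derivedTensor C).obj ((γ C).obj X')).map ((γ C).map g)) ≫ φ X' Y' =
      φ X Y ≫ (γ C).map (f ⊗ₘ g) := by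
    have h₁ := resolutionTensor_naturality f g
    have h₂ : (((derivedTensor C).map ((γ C).map (CofibrantObject.HoCat.resolutionMap f))).app _ ≫
        ((derivedTensor C).obj _).map ((γ C).map (CofibrantObject.HoCat.resolutionMap g))) ≫ _ =
        _ ≫ (γ C).map (CofibrantObject.HoCat.resolutionMap f ⊗ₘ
          CofibrantObject.HoCat.resolutionMap g) := tensorHoIso_hom_naturality
      (CofibrantObject.homMk (CofibrantObject.HoCat.resolutionMap f))
      (CofibrantObject.homMk (CofibrantObject.HoCat.resolutionMap g))
    dsimp only [φ]
    rw [← cancel_epi (resolutionTensor X Y), ← Category.assoc, h₁]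
    simp only [Category.assoc, IsIso.hom_inv_id_assoc] at h₂ ⊢
    rw [reassoc_of% h₂, ← Functor.map_comp, ← Functor.map_comp, tensorHom_comp_tensorHom,
      tensorHom_comp_tensorHom, CofibrantObject.HoCat.resolutionMap_fac,
      CofibrantObject.HoCat.resolutionMap_fac]
  { app X :=
      { app Y := φ X Y
        naturality Y Y' g := by simpa using hφ (𝟙 X) g }
    naturality X X' f := by
      ext Y
      simpa using hφ f (𝟙 Y) }

end Tensor

/-! ### Bousfield bilocalizations -/

section Functors

variable {C : Type u₁} [Category.{v₁} C] [ModelCategory C]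
  {D : Type u₂} [Category.{v₂} D] [ModelCategory D]

/-- A functor between model categories is homotopical if it preserves weak equivalences. -/
class Homotopical (F : C ⥤ D) : Prop where
  weakEquivalence_map {X Y : C} (f : X ⟶ Y) [WeakEquivalence f] : WeakEquivalence (F.map f)

lemma Homotopical.isInvertedBy (F : C ⥤ D) [Homotopical F] :
    (weakEquivalences C).IsInvertedBy (F ⋙ γ D) := fun _ _ f hf ↦ by
  have : WeakEquivalence f := (weakEquivalence_iff _).2 hf
  have := Homotopical.weakEquivalence_map (F := F) f
  exact isIso_γ_map (F.map f)

/-- The functor induced by a homotopical functor on homotopy categories. -/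
def mapHo (F : C ⥤ D) [Homotopical F] : Ho C ⥤ Ho D :=
  Localization.lift (F ⋙ γ D) (Homotopical.isInvertedBy F) (γ C)

/-- `mapHo F` is induced by `F`. -/
def mapHoIso (F : C ⥤ D) [Homotopical F] : γ C ⋙ mapHo F ≅ F ⋙ γ D :=
  Localization.fac (F ⋙ γ D) (Homotopical.isInvertedBy F) (γ C)

/-- The structure of a Bousfield bilocalization on a homotopical functor: the induced functor of
homotopy categories is both a localization and a colocalization, that is, it has a fully faithful
left adjoint `lowerStar` and a fully faithful right adjoint `lowerShriek`. -/
structure BousfieldBilocalization (F : C ⥤ D) [Homotopical F] where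
  /-- the homotopically fully faithful left adjoint -/
  lowerStar : Ho D ⥤ Ho C
  /-- the homotopically fully faithful right adjoint -/
  lowerShriek : Ho D ⥤ Ho C
  /-- the adjunction with the left adjoint -/
  adj : lowerStar ⊣ mapHo F
  /-- the adjunction with the right adjoint -/
  adjShriek : mapHo F ⊣ lowerShriek
  full_lowerStar : lowerStar.Full
  faithful_lowerStar : lowerStar.Faithful
  full_lowerShriek : lowerShriek.Full
  faithful_lowerShriek : lowerShriek.Faithful

variable [MonoidalCategory C] [SymmetricCategory C] [MonoidalClosed C] [MonoidalModelCategory C]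
  [MonoidalCategory D] [SymmetricCategory D] [MonoidalClosed D] [MonoidalModelCategory D]

/-- For cofibrant `X` and `Y`, the map from the derived tensor product of `F X` and `F Y` to
`F (X ⊗ Y)` given by the lax monoidal structure of `F`, as a natural transformation. -/
def cofibrantμ (F : C ⥤ D) [F.LaxMonoidal] :
    (((Functor.whiskeringLeft₂ (Ho D)).obj (CofibrantObject.ι ⋙ F ⋙ γ D)).obj
      (CofibrantObject.ι ⋙ F ⋙ γ D)).obj (derivedTensor D) ⟶
    (((Functor.whiskeringLeft₂ (Ho D)).obj CofibrantObject.ι).obj CofibrantObject.ι).obj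
      (curriedTensor C ⋙ (Functor.whiskeringRight _ _ _).obj (F ⋙ γ D)) where
  app X :=
    { app Y := ((derivedTensorCounit D).app (F.obj X.obj)).app (F.obj Y.obj) ≫
        (γ D).map (Functor.LaxMonoidal.μ F X.obj Y.obj)
      naturality Y Y' g := by
        have h := ((derivedTensorCounit D).app (F.obj X.obj)).naturality (F.map g.hom)
        dsimp at h ⊢
        rw [reassoc_of% h, ← Functor.map_comp, Functor.LaxMonoidal.μ_natural_right,
          Functor.map_comp, Category.assoc] }
  naturality X X' f := by
    ext Y
    have h := NatTrans.congr_app ((derivedTensorCounit D).naturality (F.map f.hom)) (F.obj Y.obj)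
    dsimp at h ⊢
    rw [reassoc_of% h, ← Functor.map_comp, Functor.LaxMonoidal.μ_natural_left,
      Functor.map_comp, Category.assoc]

instance liftingSource (F : C ⥤ D) [Homotopical F] :
    Localization.Lifting₂ (γc C) (γc C) (weakEquivalences (CofibrantObject C))
      (weakEquivalences (CofibrantObject C))
      ((((Functor.whiskeringLeft₂ (Ho D)).obj (CofibrantObject.ι ⋙ F ⋙ γ D)).obj
        (CofibrantObject.ι ⋙ F ⋙ γ D)).obj (derivedTensor D))
      ((((Functor.whiskeringLeft₂ (Ho D)).obj (mapHo F)).obj (mapHo F)).obj (derivedTensor D)) where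
  iso :=
    let e : γc C ⋙ mapHo F ≅ CofibrantObject.ι ⋙ F ⋙ γ D :=
      Functor.isoWhiskerLeft CofibrantObject.ι (mapHoIso F)
    ((((Functor.whiskeringLeft₂ (Ho D)).mapIso e).app (γc C ⋙ mapHo F)).app (derivedTensor D) ≪≫
      (((Functor.whiskeringLeft₂ (Ho D)).obj (CofibrantObject.ι ⋙ F ⋙ γ D)).mapIso e).app
        (derivedTensor D) :
      (((Functor.whiskeringLeft₂ (Ho D)).obj (γc C ⋙ mapHo F)).obj (γc C ⋙ mapHo F)).obj
        (derivedTensor D) ≅ _)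

instance liftingTarget (F : C ⥤ D) [Homotopical F] :
    Localization.Lifting₂ (γc C) (γc C) (weakEquivalences (CofibrantObject C))
      (weakEquivalences (CofibrantObject C))
      ((((Functor.whiskeringLeft₂ (Ho D)).obj CofibrantObject.ι).obj CofibrantObject.ι).obj
        (curriedTensor C ⋙ (Functor.whiskeringRight _ _ _).obj (F ⋙ γ D)))
      (derivedTensor C ⋙ (Functor.whiskeringRight _ _ _).obj (mapHo F)) where
  iso :=
    Functor.isoWhiskerRight (Localization.Lifting₂.iso (γc C) (γc C)
      (weakEquivalences (CofibrantObject C)) (weakEquivalences (CofibrantObject C))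
      (cofibrantTensor C) (derivedTensor C)) ((Functor.whiskeringRight _ _ _).obj (mapHo F)) ≪≫
    ((Functor.whiskeringLeft₂ (Ho D)).obj CofibrantObject.ι |>.obj CofibrantObject.ι).mapIso
      (Functor.isoWhiskerLeft (curriedTensor C)
        ((Functor.whiskeringRight _ _ _).mapIso (mapHoIso F)))

/-- The lax monoidal structure on `mapHo F` for the derived tensor products, induced by the lax
monoidal structure of `F`. -/
def derivedμ (F : C ⥤ D) [Homotopical F] [F.LaxMonoidal] (X Y : Ho C) :
    tensorHo ((mapHo F).obj X) ((mapHo F).obj Y) ⟶ (mapHo F).obj (tensorHo X Y) :=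
  ((Localization.lift₂NatTrans (γc C) (γc C) (weakEquivalences (CofibrantObject C))
    (weakEquivalences (CofibrantObject C)) _ _
    ((((Functor.whiskeringLeft₂ (Ho D)).obj (mapHo F)).obj (mapHo F)).obj (derivedTensor D))
    (derivedTensor C ⋙ (Functor.whiskeringRight _ _ _).obj (mapHo F))
    (cofibrantμ F)).app X).app Y

/-- A homotopical functor with a lax symmetric monoidal structure is homotopically symmetric
monoidal if its structure maps are isomorphisms for the derived tensor products. -/
class HomotopicallySymmetricMonoidal (F : C ⥤ D) [Homotopical F] [F.LaxBraided] : Prop where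
  weakEquivalence_ε : WeakEquivalence (Functor.LaxMonoidal.ε F)
  isIso_derivedμ (X Y : Ho C) : IsIso (derivedμ F X Y)

variable {F : C ⥤ D} [Homotopical F]

/-- The map `F_* (X ⊗ Y) ⟶ F_* X ⊗ F_* Y` adjoint to
`X ⊗ Y ⟶ F (F_* X) ⊗ F (F_* Y) ⟶ F (F_* X ⊗ F_* Y)`. -/
def BousfieldBilocalization.nabla (B : BousfieldBilocalization F) [F.LaxMonoidal] (X Y : Ho D) :
    B.lowerStar.obj (tensorHo X Y) ⟶ tensorHo (B.lowerStar.obj X) (B.lowerStar.obj Y) :=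
  (B.adj.homEquiv _ _).symm
    (((derivedTensor D).map (B.adj.unit.app X)).app Y ≫
      ((derivedTensor D).obj _).map (B.adj.unit.app Y) ≫
      derivedμ F (B.lowerStar.obj X) (B.lowerStar.obj Y))

/-- `F_* (F X)`, as an object of the homotopy category. -/
abbrev BousfieldBilocalization.coreflection (B : BousfieldBilocalization F) (X : C) : Ho C :=
  B.lowerStar.obj ((γ D).obj (F.obj X))

/-- The counit `c_X : F_* (F X) ⟶ X`. -/
def BousfieldBilocalization.counit (B : BousfieldBilocalization F) (X : C) :
    B.coreflection X ⟶ (γ C).obj X :=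
  B.lowerStar.map ((mapHoIso F).inv.app X) ≫ B.adj.counit.app ((γ C).obj X)

/-- The map `F V ⊗ F X ⟶ F (V ⊗ X) ≅ F X` from the derived tensor product, where `V` is
the unit object. -/
def unitAction (F : C ⥤ D) [F.LaxMonoidal] (X : C) :
    tensorHo ((γ D).obj (F.obj (𝟙_ C))) ((γ D).obj (F.obj X)) ⟶ (γ D).obj (F.obj X) :=
  ((derivedTensorCounit D).app (F.obj (𝟙_ C))).app (F.obj X) ≫
    (γ D).map (Functor.LaxMonoidal.μ F (𝟙_ C) X ≫ F.map (λ_ X).hom)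

end Functors

end

end Bilocalization

open Bilocalization

namespace Bilocalization

noncomputable section

/-! ### Objects and morphisms of the homotopy category -/

section Ho

variable {C : Type u} [Category.{v} C] [ModelCategory C]

/-! Work in the homotopy categories, write `F` for `mapHo F` and put T(X) = F_*(F V) ⊗ X. Call an
object of Ho(M) colocal if the counit of F_* ⊣ F at it is an isomorphism. Since F_* is fully
faithful, its values are colocal, and `F` inverts all counits. A map between colocal objects is an
isomorphism as soon as `F` inverts it (`isIso_of_isIso_map`).

The main point is that T(X) is nearly colocal. The object T(V) ≅ F_*(F V) is colocal, so for each f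
: V ⟶ X the map T(f) factors through the counit at T(X). As V generates, the maps T(f) are jointly
epimorphic (`tensorHo_hom_ext`): by tensor-hom adjunction, distinct maps Z ⊗ X ⟶ Y correspond to
distinct maps from X to the internal hom. Hence the counit at T(X) is an epimorphism
(`epi_counit_app`).

For the first claim, the monoidality of `F` gives F(T(X)) ≅ F V ⊗ F X ≅ F X. If this is
contractible, so is F_*(F(T(X))), and T(X) is an epimorphic image of it. The converse holds because
`F`, having a right adjoint, preserves the initial object.

In the stable case every epimorphism splits (`exists_section_of_epi`), and a split counit is
invertible (`isIso_counit_app_of_section`). So T(X) is colocal. Then the second and third maps of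
the zig-zag join colocal objects and are inverted by `F`, while the first is F_* of an isomorphism.
-/

/-- The natural transformation from the constant functor at the zero object to the identity of the
homotopy category. -/
def fromZero [HasZeroObject C] : (Functor.const (Ho C)).obj ((γ C).obj 0) ⟶ 𝟭 (Ho C) :=
  letI : Localization.Lifting (γ C) (weakEquivalences C)
      ((Functor.const C).obj ((γ C).obj 0)) ((Functor.const (Ho C)).obj ((γ C).obj 0)) :=
    ⟨Iso.refl _⟩
  Localization.liftNatTrans (γ C) (weakEquivalences C) ((Functor.const C).obj ((γ C).obj 0)) (γ C)
    ((Functor.const (Ho C)).obj ((γ C).obj 0)) (𝟭 (Ho C))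
    { app X := (γ C).map ((isZero_zero C).to_ X)
      naturality X Y f := by
        rw [← Functor.map_comp, (isZero_zero C).eq_of_src ((isZero_zero C).to_ X ≫ f)
          ((isZero_zero C).to_ Y)]
        exact Category.id_comp _ }

lemma fromZero_app [HasZeroObject C] (X : C) :
    fromZero.app ((γ C).obj X) = (γ C).map ((isZero_zero C).to_ X) := by
  dsimp only [fromZero]
  rw [Localization.liftNatTrans_app]
  exact (Category.id_comp _).trans (Category.comp_id _)

variable (C) in
/-- The zero object is initial in the homotopy category. -/
def isInitialZeroHo [HasZeroObject C] : IsInitial ((γ C).obj (0 : C)) :=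
  IsInitial.ofUniqueHom (fun X ↦ fromZero.app X) (fun X f ↦ by
    -- Naturality at `f` suffices for uniqueness, because the component of `fromZero` at the zero
    -- object is the identity.
    have h := fromZero.naturality f
    have h₀ : fromZero.app ((γ C).obj (0 : C)) = 𝟙 _ := by
      rw [fromZero_app, (isZero_zero C).eq_of_src ((isZero_zero C).to_ 0) (𝟙 _)]
      exact (γ C).map_id 0
    rw [h₀] at h
    exact (Category.id_comp f).symm.trans (h.symm.trans (Category.id_comp _)))

lemma IsContractible.hom_ext [HasZeroObject C] {X Y : Ho C} (hX : IsContractible X)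
    (f g : X ⟶ Y) : f = g :=
  ((isInitialZeroHo C).ofIso hX.some.symm).hom_ext f g

lemma IsContractible.of_iso [HasZeroObject C] {X Y : Ho C} (hX : IsContractible X) (e : X ≅ Y) :
    IsContractible Y :=
  ⟨e.symm ≪≫ hX.some⟩

lemma isContractible_of_isInitial [HasZeroObject C] {X : Ho C} (hX : IsInitial X) :
    IsContractible X :=
  ⟨hX.uniqueUpToIso (isInitialZeroHo C)⟩

lemma exists_iso_γ_obj (X : Ho C) : ∃ X' : C, Nonempty ((γ C).obj X' ≅ X) :=
  ⟨_, ⟨(γ C).objObjPreimageIso X⟩⟩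

lemma exists_iso_γ_obj_of_isCofibrant (X : Ho C) :
    ∃ X' : C, IsCofibrant X' ∧ Nonempty ((γ C).obj X' ≅ X) := by
  obtain ⟨X', ⟨e⟩⟩ := exists_iso_γ_obj X
  have := isIso_γ_map (CofibrantObject.HoCat.pResolutionObj X')
  exact ⟨_, inferInstance, ⟨asIso ((γ C).map (CofibrantObject.HoCat.pResolutionObj X')) ≪≫ e⟩⟩

lemma exists_iso_γ_obj_of_isFibrant (X : Ho C) :
    ∃ X' : C, IsFibrant X' ∧ Nonempty ((γ C).obj X' ≅ X) := by
  obtain ⟨X', ⟨e⟩⟩ := exists_iso_γ_obj X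
  have := isIso_γ_map (FibrantObject.HoCat.iResolutionObj X')
  exact ⟨_, inferInstance, ⟨(asIso ((γ C).map (FibrantObject.HoCat.iResolutionObj X'))).symm ≪≫ e⟩⟩

lemma exists_iso_γ_obj_of_isBifibrant (X : Ho C) :
    ∃ X' : C, IsCofibrant X' ∧ IsFibrant X' ∧ Nonempty ((γ C).obj X' ≅ X) := by
  obtain ⟨X', _, ⟨e⟩⟩ := exists_iso_γ_obj_of_isFibrant X
  have := isIso_γ_map (CofibrantObject.HoCat.pResolutionObj X')
  exact ⟨_, inferInstance, inferInstance,
    ⟨asIso ((γ C).map (CofibrantObject.HoCat.pResolutionObj X')) ≪≫ e⟩⟩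

/-- The identity of `Y` and the composite of `Y ⟶ 0 ⟶ Y` agree after precomposition with `f`, since
the source of `f` is initial; so they are equal. -/
lemma IsContractible.of_epi [HasZeroObject C] {X Y : Ho C} (hX : IsContractible X) (f : X ⟶ Y)
    [Epi f] : IsContractible Y := by
  obtain ⟨Y', ⟨e⟩⟩ := exists_iso_γ_obj Y
  refine ⟨e.inv ≫ (γ C).map ((isZero_zero C).from_ Y'), (isInitialZeroHo C).to Y, ?_,
    (isInitialZeroHo C).hom_ext _ _⟩
  rw [← cancel_epi f]
  exact hX.hom_ext _ _

end Ho

/-! ### The unit of the derived tensor product, and joint epimorphisms -/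

section Tensor

variable {C : Type u} [Category.{v} C] [ModelCategory C] [MonoidalCategory C]
  [SymmetricCategory C] [MonoidalClosed C] [MonoidalModelCategory C]

lemma weakEquivalence_whiskerLeft_unit {Q : C} (q : Q ⟶ 𝟙_ C) [IsCofibrant Q] [WeakEquivalence q]
    (X : C) [IsCofibrant X] : WeakEquivalence (X ◁ q) := by
  have := MonoidalModelCategory.weakEquivalence_whiskerRight_unit q X
  have h : X ◁ q = (β_ X Q).hom ≫ q ▷ X ≫ (β_ X (𝟙_ C)).inv := by
    rw [← BraidedCategory.braiding_naturality_right_assoc, Iso.hom_inv_id, Category.comp_id]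
  rw [h]
  infer_instance

lemma isIso_derivedTensorCounit_app_app (X Y : C)
    (h : WeakEquivalence (CofibrantObject.HoCat.pResolutionObj X ⊗ₘ
      CofibrantObject.HoCat.pResolutionObj Y)) :
    IsIso (((derivedTensorCounit C).app X).app Y) := by
  have := isIso_γ_map (CofibrantObject.HoCat.pResolutionObj X ⊗ₘ
      CofibrantObject.HoCat.pResolutionObj Y)
  change IsIso (inv (resolutionTensor X Y) ≫
      (tensorHoIso (CofibrantObject.mk (CofibrantObject.HoCat.resolutionObj X))
        (CofibrantObject.mk (CofibrantObject.HoCat.resolutionObj Y))).hom ≫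
      (γ C).map (CofibrantObject.HoCat.pResolutionObj X ⊗ₘ CofibrantObject.HoCat.pResolutionObj Y))
  infer_instance

/-- The unit axiom handles the resolution of the unit tensored with the cofibrant resolution of `Y`.
After that, tensoring with the unit itself preserves all weak equivalences, so `Y` need not be
cofibrant. -/
instance (Y : C) : IsIso (((derivedTensorCounit C).app (𝟙_ C)).app Y) := by
  apply isIso_derivedTensorCounit_app_app
  have := MonoidalModelCategory.weakEquivalence_whiskerRight_unit
    (CofibrantObject.HoCat.pResolutionObj (𝟙_ C)) (CofibrantObject.HoCat.resolutionObj Y)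
  have h : 𝟙_ C ◁ CofibrantObject.HoCat.pResolutionObj Y = (λ_ _).hom ≫
      CofibrantObject.HoCat.pResolutionObj Y ≫ (λ_ _).inv := by simp
  rw [MonoidalCategory.tensorHom_def, h]
  infer_instance

instance (X : C) : IsIso (((derivedTensorCounit C).app X).app (𝟙_ C)) := by
  apply isIso_derivedTensorCounit_app_app
  have := weakEquivalence_whiskerLeft_unit
    (CofibrantObject.HoCat.pResolutionObj (𝟙_ C)) (CofibrantObject.HoCat.resolutionObj X)
  have h : CofibrantObject.HoCat.pResolutionObj X ▷ 𝟙_ C = (ρ_ _).hom ≫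
      CofibrantObject.HoCat.pResolutionObj X ≫ (ρ_ _).inv := by simp
  rw [MonoidalCategory.tensorHom_def', h]
  infer_instance

/-! ### The tensor-hom adjunction in the homotopy category. -/

lemma fibration_ihom_map (Q : C) [IsCofibrant Q] {A B : C} (f : A ⟶ B) [Fibration f] :
    Fibration ((ihom Q).map f) := by
  rw [fibration_iff, ← MorphismProperty.rlp_eq_of_wfs (trivialCofibrations C) (fibrations C)]
  intro X Y i hi
  obtain ⟨_, _⟩ := (mem_trivialCofibrations_iff i).1 hi
  have h₁ : Cofibration (Q ◁ i) := MonoidalModelCategory.cofibration_whiskerLeft Q i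
  have h₂ : WeakEquivalence (Q ◁ i) := MonoidalModelCategory.weakEquivalence_whiskerLeft Q i
  exact ((ihom.adjunction Q).hasLiftingProperty_iff i f).1
    (inferInstanceAs (HasLiftingProperty (Q ◁ i) f))

lemma weakEquivalence_ihom_map (Q : C) [IsCofibrant Q] {A B : C} (f : A ⟶ B) [Fibration f]
    [WeakEquivalence f] : WeakEquivalence ((ihom Q).map f) := by
  suffices trivialFibrations C ((ihom Q).map f) from ((mem_trivialFibrations_iff _).1 this).2
  rw [← MorphismProperty.rlp_eq_of_wfs (cofibrations C) (trivialFibrations C)]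
  intro X Y i hi
  have : Cofibration i := (cofibration_iff i).2 hi
  have h₁ : Cofibration (Q ◁ i) := MonoidalModelCategory.cofibration_whiskerLeft Q i
  exact ((ihom.adjunction Q).hasLiftingProperty_iff i f).1
    (inferInstanceAs (HasLiftingProperty (Q ◁ i) f))

instance (Q X : C) [IsCofibrant Q] [IsCofibrant X] : IsCofibrant (Q ⊗ X) := by
  have : Cofibration (initial.to X) := (isCofibrant_iff X).1 inferInstance
  have := MonoidalModelCategory.cofibration_whiskerLeft Q (initial.to X)
  exact (isCofibrant_iff_of_isInitial (Q ◁ initial.to X)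
    (initialIsInitial.isInitialObj (tensorLeft Q) _)).2 this

lemma isFibrant_ihom_obj (Q : C) [IsCofibrant Q] (Y : C) [IsFibrant Y] :
    IsFibrant ((ihom Q).obj Y) := by
  have : Fibration (terminal.from Y) := (isFibrant_iff Y).1 inferInstance
  have := fibration_ihom_map Q (terminal.from Y)
  exact (isFibrant_iff_of_isTerminal ((ihom Q).map (terminal.from Y))
    (terminalIsTerminal.isTerminalObj (ihom Q) _)).2 this

open MonoidalClosed in
/-- Transposition along `Q ⊗ - ⊣ ihom Q` is compatible with equality in the homotopy category. -/
lemma γ_map_curry_eq (Q : C) [IsCofibrant Q] {X Y : C} [IsCofibrant X] [IsFibrant Y]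
    {f g : Q ⊗ X ⟶ Y} (h : (γ C).map f = (γ C).map g) :
    (γ C).map (curry f) = (γ C).map (curry g) := by
  obtain ⟨P, _, ⟨H, H₀, H₁⟩⟩ := ((RightHomotopyRel.iff_map_eq (γ C) _ _).2 h).exists_good_pathObject
  have h₀ := weakEquivalence_ihom_map Q P.p₀
  -- `(ihom Q).map P.ι` is a section of the trivial fibration `(ihom Q).map P.p₀`. Being invertible
  -- in the homotopy category, it forces the two projections of `P` to become equal there.
  have h₁ : WeakEquivalence ((ihom Q).map P.ι) := by
    have : (ihom Q).map P.ι ≫ (ihom Q).map P.p₀ = 𝟙 _ := by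
      rw [← Functor.map_comp, P.ι_p₀, CategoryTheory.Functor.map_id]
    exact weakEquivalence_of_postcomp_of_fac this
  have h₂ := isIso_γ_map ((ihom Q).map P.ι)
  have h₃ : (γ C).map ((ihom Q).map P.p₀) = (γ C).map ((ihom Q).map P.p₁) := by
    rw [← cancel_epi ((γ C).map ((ihom Q).map P.ι))]
    simp only [← Functor.map_comp, P.ι_p₀, P.ι_p₁]
  rw [← H₀, ← H₁, curry_natural_right, curry_natural_right, Functor.map_comp, h₃,
    Functor.map_comp]

-- Dual to the preceding argument: `Q ⊗ -` preserves trivial cofibrations, so the two ends of the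
-- tensored cylinder become equal in the homotopy category.
open MonoidalClosed in
lemma γ_map_eq_of_curry (Q : C) [IsCofibrant Q] {X Y : C} [IsCofibrant X] [IsFibrant Y]
    {f g : Q ⊗ X ⟶ Y} (h : (γ C).map (curry f) = (γ C).map (curry g)) :
    (γ C).map f = (γ C).map g := by
  have := isFibrant_ihom_obj Q Y
  obtain ⟨P, _, ⟨H, H₀, H₁⟩⟩ := ((LeftHomotopyRel.iff_map_eq (γ C) _ _).2 h).exists_good_cylinder
  have h₀ := MonoidalModelCategory.weakEquivalence_whiskerLeft Q P.i₀
  have h₁ : WeakEquivalence (Q ◁ P.π) := by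
    have : Q ◁ P.i₀ ≫ Q ◁ P.π = 𝟙 _ := by
      rw [← whiskerLeft_comp, P.i₀_π, whiskerLeft_id]
    exact weakEquivalence_of_precomp_of_fac this
  have h₂ := isIso_γ_map (Q ◁ P.π)
  have h₃ : (γ C).map (Q ◁ P.i₀) = (γ C).map (Q ◁ P.i₁) := by
    rw [← cancel_mono ((γ C).map (Q ◁ P.π))]
    simp only [← Functor.map_comp, ← whiskerLeft_comp, P.i₀_π, P.i₁_π]
  rw [← uncurry_curry f, ← uncurry_curry g, ← H₀, ← H₁, uncurry_natural_left,
    uncurry_natural_left, Functor.map_comp, h₃, Functor.map_comp]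

/-- If the unit generates `C`, the morphisms `Z ⊗ f` for `f : 𝟙_ C ⟶ X` in the homotopy category
are jointly epimorphic. -/
lemma tensorHo_hom_ext (hV : Generates ({𝟙_ C} : Set C)) {Z X Y : Ho C} (h h' : tensorHo Z X ⟶ Y)
    (w : ∀ f : (γ C).obj (𝟙_ C) ⟶ X,
      ((derivedTensor C).obj Z).map f ≫ h = ((derivedTensor C).obj Z).map f ≫ h') : h = h' := by
  obtain ⟨Q, _, ⟨z⟩⟩ := exists_iso_γ_obj_of_isCofibrant Z
  -- `X'` is cofibrant so that maps `Q ⊗ X' ⟶ Y'` represent all maps in the homotopy category, and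
  -- fibrant so that maps from the resolved unit to `X'` do too.
  obtain ⟨X', _, _, ⟨x⟩⟩ := exists_iso_γ_obj_of_isBifibrant X
  obtain ⟨Y', _, ⟨y⟩⟩ := exists_iso_γ_obj_of_isFibrant Y
  let E (A : C) [IsCofibrant A] : (γ C).obj (Q ⊗ A) ≅ tensorHo Z ((γ C).obj A) :=
    (tensorHoIso (CofibrantObject.mk Q) (CofibrantObject.mk A)).symm ≪≫
      ((derivedTensor C).mapIso z).app _
  have hE {A B : C} [IsCofibrant A] [IsCofibrant B] (f : A ⟶ B) :
      (γ C).map (Q ◁ f) ≫ (E B).hom =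
        (E A).hom ≫ ((derivedTensor C).obj Z).map ((γ C).map f) := by
    have := tensorHoIso_hom_naturality (𝟙 (CofibrantObject.mk Q))
      (CofibrantObject.homMk f : CofibrantObject.mk A ⟶ CofibrantObject.mk B)
    dsimp [E] at this ⊢
    simp only [CategoryTheory.Functor.map_id, NatTrans.id_app, Category.id_comp, id_tensorHom] at this
    rw [Category.assoc, ← NatTrans.naturality, ← Category.assoc, ← Category.assoc]
    congr 1
    rw [Iso.eq_inv_comp, ← Category.assoc, Iso.comp_inv_eq]
    exact this.symm
  let e : (γ C).obj (Q ⊗ X') ≅ tensorHo Z X := E X' ≪≫ ((derivedTensor C).obj Z).mapIso x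
  obtain ⟨k, hk⟩ := map_surjective_of_isLocalization (γ C) _ _ (e.hom ≫ h ≫ y.inv)
  obtain ⟨k', hk'⟩ := map_surjective_of_isLocalization (γ C) _ _ (e.hom ≫ h' ≫ y.inv)
  suffices (γ C).map k = (γ C).map k' by
    rwa [hk, hk', cancel_epi, cancel_mono] at this
  apply γ_map_eq_of_curry
  by_contra hne
  obtain ⟨S, rfl, f, hf⟩ := hV _ _ hne
  apply hf
  have hp := isIso_γ_map (CofibrantObject.HoCat.pResolutionObj (𝟙_ C))
  obtain ⟨g, hg⟩ := map_surjective_of_isLocalization (γ C) _ _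
    ((γ C).map (CofibrantObject.HoCat.pResolutionObj (𝟙_ C)) ≫ f)
  rw [← cancel_epi ((γ C).map (CofibrantObject.HoCat.pResolutionObj (𝟙_ C))), ← Category.assoc,
    ← Category.assoc, ← hg, ← Functor.map_comp, ← Functor.map_comp,
    ← MonoidalClosed.curry_natural_left, ← MonoidalClosed.curry_natural_left]
  apply γ_map_curry_eq
  have hw := w (inv ((γ C).map (CofibrantObject.HoCat.pResolutionObj (𝟙_ C))) ≫
    (γ C).map g ≫ x.hom)
  simp only [Functor.map_comp, Category.assoc, cancel_epi] at hw
  have := reassoc_of% hE g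
  simp only [Functor.map_comp, hk, hk', e, Iso.trans_hom, Functor.mapIso_hom, Category.assoc, this]
  rw [reassoc_of% hw]

end Tensor

/-! ### Splitting of epimorphisms in stable homotopy categories -/

/-- Cancellation of pasted pushouts: the map of quotients `s` is a cobase change of `k`, so it
inherits being a trivial cofibration. -/
lemma isPushout_desc {C : Type u} [Category.{v} C] {A B K S L T : C} {i : A ⟶ K} {t : A ⟶ B} {q : K ⟶ S} {b : B ⟶ S}
    (sq : IsPushout i t q b) {k : K ⟶ L} {j : A ⟶ L} {q' : L ⟶ T} {b' : B ⟶ T}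
    (sq' : IsPushout j t q' b') (hk : i ≫ k = j) {s : S ⟶ T} (hq : q ≫ s = k ≫ q')
    (hb : b ≫ s = b') : IsPushout k q q' s := by
  subst hk hb
  exact IsPushout.of_left sq' hq.symm sq

section Stable

variable {C : Type u} [Category.{v} C] [ModelCategory C]

/-- A morphism to a fibrant object extends along a cofibration if this is true up to homotopy. -/
lemma exists_extension {A B W : C} (i : A ⟶ B) [Cofibration i] [IsCofibrant A] [IsFibrant W]
    {f : A ⟶ W} {g : B ⟶ W} (h : (γ C).map f = (γ C).map (i ≫ g)) : ∃ l : B ⟶ W, i ≫ l = f := by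
  obtain ⟨P, _, ⟨H⟩⟩ := ((RightHomotopyRel.iff_map_eq (γ C) _ _).2 h.symm).exists_good_pathObject
  obtain ⟨l, H', hl⟩ := H.homotopy_extension i g rfl
  exact ⟨l, by rw [← H'.h₁, reassoc_of% hl, H.h₁]⟩

lemma weakEquivalence_of_isPushout {A B A' B' : C} {f : A ⟶ B} {g : A ⟶ A'} {f' : A' ⟶ B'}
    {g' : B ⟶ B'} (sq : IsPushout f g g' f') [Cofibration f] [WeakEquivalence f] :
    WeakEquivalence f' :=
  ((mem_trivialCofibrations_iff f').1
    ((trivialCofibrations C).of_isPushout sq.flip (mem_trivialCofibrations f))).2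

/-- Cobase change preserves weak equivalences between cofibrations. -/
lemma weakEquivalence_of_cobaseChange {A B K S L T : C} {i : A ⟶ K} {t : A ⟶ B} {q : K ⟶ S}
    {b : B ⟶ S} [Cofibration i] (sq : IsPushout i t q b) {k : K ⟶ L} {j : A ⟶ L} {q' : L ⟶ T}
    {b' : B ⟶ T} [Cofibration j] (sq' : IsPushout j t q' b') (hk : i ≫ k = j) {s : S ⟶ T}
    (hq : q ≫ s = k ≫ q') (hb : b ≫ s = b') [WeakEquivalence k] : WeakEquivalence s := by
  -- Ken Brown's argument under `A`: `k` factors as the trivial cofibration `x` followed by a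
  -- retraction `d.p` of the trivial cofibration `y`. Cobase change preserves trivial cofibrations
  -- and the retraction identity, so `s` is again a composite of weak equivalences.
  let d := MorphismProperty.factorizationData (cofibrations C) (trivialFibrations C)
    (pushout.desc k (𝟙 L) (by simpa using hk) : pushout i j ⟶ L)
  have hp := (mem_trivialFibrations_iff d.p).1 d.hp
  have := hp.2
  let x : K ⟶ d.Z := pushout.inl i j ≫ d.i
  let y : L ⟶ d.Z := pushout.inr i j ≫ d.i
  have hxy : i ≫ x = j ≫ y := pushout.condition_assoc _
  have hx : x ≫ d.p = k := by simp only [x, Category.assoc, d.fac, pushout.inl_desc]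
  have hy : y ≫ d.p = 𝟙 L := by simp only [y, Category.assoc, d.fac, pushout.inr_desc]
  have : WeakEquivalence x := weakEquivalence_of_postcomp_of_fac hx
  have : WeakEquivalence y := weakEquivalence_of_postcomp_of_fac hy
  have : Cofibration d.i := (cofibration_iff _).2 d.hi
  have : Cofibration x := by dsimp only [x]; infer_instance
  have : Cofibration y := by dsimp only [y]; infer_instance
  have sqZ := IsPushout.of_hasPushout (j ≫ y) t
  let x' := sq.desc (x ≫ pushout.inl (j ≫ y) t) (pushout.inr _ _)
    ((reassoc_of% hxy) _ |>.trans ((Category.assoc _ _ _).symm.trans sqZ.w))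
  let y' := sq'.desc (y ≫ pushout.inl (j ≫ y) t) (pushout.inr _ _)
    ((Category.assoc _ _ _).symm.trans sqZ.w)
  let r := sqZ.desc (d.p ≫ q') b' (by
    rw [Category.assoc, reassoc_of% hy, sq'.w])
  have : WeakEquivalence x' := weakEquivalence_of_isPushout
    (isPushout_desc sq sqZ hxy (sq.inl_desc _ _ _) (sq.inr_desc _ _ _))
  have : WeakEquivalence y' := weakEquivalence_of_isPushout
    (isPushout_desc sq' sqZ rfl (sq'.inl_desc _ _ _) (sq'.inr_desc _ _ _))
  have hr : y' ≫ r = 𝟙 T := sq'.hom_ext (by simp [y', r, reassoc_of% hy]) (by simp [y', r])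
  have : WeakEquivalence r := weakEquivalence_of_precomp_of_fac hr
  have hs : x' ≫ r = s :=
    sq.hom_ext (by simp [x', r, reassoc_of% hx, hq]) (by simp [x', r, hb])
  rw [← hs]
  infer_instance

variable [HasZeroObject C]

/-- If `p` becomes an epimorphism in the homotopy category, then its suspension becomes a split
epimorphism. -/
lemma SuspensionModel.exists_isIso_comp (D : SuspensionModel C) {P X : C} (p : P ⟶ X)
    [Epi ((γ C).map (D.Q.map p))] :
    ∃ σ : (γ C).obj (D.S.obj X) ⟶ (γ C).obj (D.S.obj P), IsIso (σ ≫ (γ C).map (D.S.map p)) := by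
  have := D.isCofibrant X
  have := D.cofibration_i X
  have := D.cofibration_i P
  have hKX := D.weakEquivalence_cone X
  have hKP := D.weakEquivalence_cone P
  have z := isZero_zero C
  -- the mapping cone of `D.Q.map p`
  let Cp := pushout (D.i.app P) (D.Q.map p)
  let f : D.Q.obj X ⟶ Cp := pushout.inr _ _
  have sqC : IsPushout (D.i.app P) (D.Q.map p) (pushout.inl _ _) f := .of_hasPushout _ _
  let c : Cp ⟶ D.S.obj P := sqC.desc (D.q.app P) (z.from_ _ ≫ z.to_ _) (by
    rw [(D.isPushout P).w, ← Category.assoc, z.eq_of_tgt (_ ≫ _)])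
  -- Collapsing `D.Q.obj X` in the mapping cone yields the suspension of `P`.
  have sqS : IsPushout f (z.from_ _) c (z.to_ (D.S.obj P)) := by
    refine IsPushout.of_top (h₁₁ := D.i.app P) (v₁₁ := D.Q.map p) (v₁₂ := pushout.inl _ _) ?_
      (sqC.inr_desc _ _ _) sqC
    rw [sqC.inl_desc, z.eq_of_tgt (_ ≫ _) (z.from_ _)]
    exact D.isPushout P
  let j := FibrantObject.HoCat.iResolutionObj Cp
  let W := FibrantObject.HoCat.resolutionObj Cp
  -- The composite of `D.Q.map p` and `f` factors through the contractible cone of `P`, and `D.Q.map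
  -- p` is an epimorphism, so `f` is null in the homotopy category.
  have hf : (γ C).map f = (γ C).map (z.from_ _ ≫ z.to_ _) := by
    rw [← cancel_epi ((γ C).map (D.Q.map p)), ← Functor.map_comp, ← Functor.map_comp, ← sqC.w,
      ← Category.assoc, z.eq_of_tgt (D.Q.map p ≫ z.from_ _) (D.i.app P ≫ z.from_ _),
      Category.assoc]
    have := isIso_γ_map (z.from_ (D.K.obj P))
    rw [Functor.map_comp, Functor.map_comp (γ C) (D.i.app P)]
    congr 1
    exact IsContractible.hom_ext ⟨asIso ((γ C).map (z.from_ (D.K.obj P)))⟩ _ _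
  -- Homotopy extension turns this vanishing into an actual map from the cone of `X`. On quotients
  -- by `D.Q.obj X`, `h` will induce the section.
  obtain ⟨h, hh⟩ : ∃ h : D.K.obj X ⟶ W, D.i.app X ≫ h = f ≫ j := by
    refine exists_extension (D.i.app X) (g := z.from_ _ ≫ z.to_ W) ?_
    rw [Functor.map_comp, hf, ← Functor.map_comp, Category.assoc, ← Category.assoc (D.i.app X),
      z.eq_of_src (z.to_ Cp ≫ j) (z.to_ W), z.eq_of_tgt (D.i.app X ≫ _) (z.from_ _)]
  -- the comparison with the cone of `X`
  let m := FibrantObject.HoCat.iResolutionObj (D.K.obj X)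
  let L := FibrantObject.HoCat.resolutionObj (D.K.obj X)
  let n : Cp ⟶ D.K.obj X := sqC.desc (D.K.map p) (D.i.app X) (D.i.naturality p).symm
  have hn : f ≫ n = D.i.app X := sqC.inr_desc _ _ _
  have sq : CommSq (n ≫ m) j (terminal.from L) (terminal.from W) :=
    ⟨terminalIsTerminal.hom_ext _ _⟩
  let u : W ⟶ L := sq.lift
  have hu : j ≫ u = n ≫ m := sq.fac_left
  have : Cofibration f := by dsimp only [f]; infer_instance
  have hj : Cofibration (f ≫ j) := inferInstance
  have hm : Cofibration (D.i.app X ≫ m) := inferInstance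
  let t := z.from_ (D.Q.obj X)
  -- `W'` and `L'` are quotients by `D.Q.obj X`. They are models of the suspensions of `P` and `X`,
  -- since `j` and `m` are trivial cofibrations.
  obtain ⟨W', w, w₀, sqW⟩ : ∃ (W' : C) (w : W ⟶ W') (w₀ : 0 ⟶ W'), IsPushout (f ≫ j) t w w₀ :=
    ⟨_, _, _, .of_hasPushout _ _⟩
  obtain ⟨L', l, l₀, sqL⟩ : ∃ (L' : C) (l : L ⟶ L') (l₀ : 0 ⟶ L'),
      IsPushout (D.i.app X ≫ m) t l l₀ :=
    ⟨_, _, _, .of_hasPushout _ _⟩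
  let j' : D.S.obj P ⟶ W' := sqS.desc (j ≫ w) w₀ (by rw [← sqW.w, Category.assoc])
  have : WeakEquivalence j' := weakEquivalence_of_isPushout
    (isPushout_desc sqS sqW rfl (sqS.inl_desc _ _ _) (sqS.inr_desc _ _ _))
  let m' : D.S.obj X ⟶ L' := (D.isPushout X).desc (m ≫ l) l₀ (by rw [← sqL.w, Category.assoc])
  have : WeakEquivalence m' := weakEquivalence_of_isPushout
    (isPushout_desc (D.isPushout X) sqL rfl ((D.isPushout X).inl_desc _ _ _)
      ((D.isPushout X).inr_desc _ _ _))
  let h' : D.S.obj X ⟶ W' := (D.isPushout X).desc (h ≫ w) w₀ (by rw [← sqW.w, reassoc_of% hh,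
    Category.assoc])
  have hhu : D.i.app X ≫ h ≫ u = D.i.app X ≫ m := by
    rw [reassoc_of% hh, hu, reassoc_of% hn]
  let u' : W' ⟶ L' := sqW.desc (u ≫ l) l₀ (by
    rw [← sqL.w, Category.assoc, reassoc_of% hu, reassoc_of% hn, Category.assoc])
  -- Both ends are contractible. Since `h ≫ u` is also a map under `D.Q.obj X`, it induces a weak
  -- equivalence of quotients.
  have : WeakEquivalence (h ≫ u) := by
    have h₁ : m ≫ z.from_ L = z.from_ _ := z.eq_of_tgt _ _
    have h₂ : (h ≫ u) ≫ z.from_ L = z.from_ _ := z.eq_of_tgt _ _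
    have : WeakEquivalence (z.from_ L) := weakEquivalence_of_precomp_of_fac h₁
    exact weakEquivalence_of_postcomp_of_fac h₂
  have : WeakEquivalence (h' ≫ u') :=
    weakEquivalence_of_cobaseChange (D.isPushout X) sqL hhu
      (by simp [h', u']) (by simp [h', u'])
  have hc : c ≫ D.S.map p = n ≫ D.q.app X := by
    apply sqC.hom_ext
    · rw [sqC.inl_desc_assoc, sqC.inl_desc_assoc, D.q.naturality]
    · rw [sqC.inr_desc_assoc, sqC.inr_desc_assoc, (D.isPushout X).w, Category.assoc,
        z.eq_of_src (z.to_ _ ≫ D.S.map p)]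
  have hS : D.S.map p ≫ m' = j' ≫ u' := by
    apply sqS.hom_ext
    · rw [reassoc_of% hc, (D.isPushout X).inl_desc, sqS.inl_desc_assoc, Category.assoc,
        sqW.inl_desc, reassoc_of% hu]
    · exact z.eq_of_src _ _
  have := isIso_γ_map j'
  have := isIso_γ_map m'
  have := isIso_γ_map (h' ≫ u')
  refine ⟨(γ C).map h' ≫ inv ((γ C).map j'), ?_⟩
  have h₁ : (((γ C).map h' ≫ inv ((γ C).map j')) ≫ (γ C).map (D.S.map p)) ≫ (γ C).map m' =
      (γ C).map (h' ≫ u') := by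
    rw [Category.assoc, Category.assoc, ← Functor.map_comp, hS, Functor.map_comp,
      IsIso.inv_hom_id_assoc, ← Functor.map_comp]
  exact IsIso.of_isIso_fac_right h₁

/-- In the homotopy category of a stable model category, all epimorphisms are split. -/
lemma exists_section_of_epi (hC : IsStable C) {A B : Ho C} (e : A ⟶ B) [Epi e] :
    ∃ s : B ⟶ A, s ≫ e = 𝟙 B := by
  obtain ⟨D, E, ⟨ι⟩⟩ := hC
  obtain ⟨P, _, ⟨a⟩⟩ := exists_iso_γ_obj_of_isCofibrant A
  obtain ⟨X, _, ⟨b⟩⟩ := exists_iso_γ_obj_of_isFibrant B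
  obtain ⟨p, hp⟩ := map_surjective_of_isLocalization (γ C) _ _ (a.hom ≫ e ≫ b.inv)
  have := D.weakEquivalence_p P
  have := D.weakEquivalence_p X
  have := isIso_γ_map (D.p.app P)
  have := isIso_γ_map (D.p.app X)
  have hQ : (γ C).map (D.Q.map p) =
      (γ C).map (D.p.app P) ≫ (γ C).map p ≫ inv ((γ C).map (D.p.app X)) := by
    rw [← Category.assoc, IsIso.eq_comp_inv, ← Functor.map_comp, ← Functor.map_comp,
      D.p.naturality]
    rfl
  have : Epi ((γ C).map (D.Q.map p)) := by
    rw [hQ, hp]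
    infer_instance
  obtain ⟨σ, hσ⟩ := D.exists_isIso_comp p
  -- Since suspension is full, the splitting map `σ` desuspends to `τ`; since suspension reflects
  -- isomorphisms, `τ` followed by `p` is invertible.
  obtain ⟨τ, hτ⟩ := E.functor.map_surjective ((ι.app X).inv ≫ σ ≫ (ι.app P).hom)
  have hn : (γ C).map (D.S.map p) ≫ (ι.app X).hom =
      (ι.app P).hom ≫ E.functor.map ((γ C).map p) := ι.hom.naturality p
  have : IsIso (E.functor.map (τ ≫ (γ C).map p)) := by
    rw [Functor.map_comp, hτ, Category.assoc, Category.assoc, ← hn, ← Category.assoc σ]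
    infer_instance
  have := isIso_of_reflects_iso (τ ≫ (γ C).map p) E.functor
  refine ⟨b.inv ≫ inv (τ ≫ (γ C).map p) ≫ τ ≫ a.hom, ?_⟩
  have he : a.hom ≫ e = (γ C).map p ≫ b.hom := by rw [hp]; simp
  simp only [Category.assoc, he]
  rw [← Category.assoc τ, IsIso.inv_hom_id_assoc, Iso.inv_hom_id]

end Stable

/-! ### Colocal objects -/

section Colocal

variable {H : Type u₁} [Category.{v₁} H] {K : Type u₂} [Category.{v₂} K] {L : K ⥤ H} {G : H ⥤ K}
  (adj : L ⊣ G)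

include adj in
lemma isIso_of_isIso_map {A B : H} [IsIso (adj.counit.app A)] [IsIso (adj.counit.app B)]
    (f : A ⟶ B) [IsIso (G.map f)] : IsIso f := by
  have h : f = inv (adj.counit.app A) ≫ L.map (G.map f) ≫ adj.counit.app B := by
    rw [IsIso.eq_inv_comp]
    exact (adj.counit.naturality f).symm
  rw [h]
  infer_instance

lemma isIso_counit_app_of_iso {A B : H} (e : A ≅ B) [IsIso (adj.counit.app A)] :
    IsIso (adj.counit.app B) := by
  have h := adj.counit.naturality e.hom
  have : IsIso ((L.map (G.map e.hom)) ≫ adj.counit.app B) := by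
    have h' : (L.map (G.map e.hom)) ≫ adj.counit.app B = adj.counit.app A ≫ e.hom := h
    rw [h']
    infer_instance
  exact IsIso.of_isIso_comp_left (L.map (G.map e.hom)) _

variable [L.Full] [L.Faithful]

instance isIso_counit_app_obj (Z : K) : IsIso (adj.counit.app (L.obj Z)) := by
  have h : L.map (adj.unit.app Z) ≫ adj.counit.app (L.obj Z) = 𝟙 _ :=
    adj.left_triangle_components Z
  exact IsIso.of_isIso_fac_left h

/-- The unit is invertible because `L` is fully faithful; the triangle identity transfers this to
`G` of the counit. -/
instance isIso_map_counit_app (A : H) : IsIso (G.map (adj.counit.app A)) :=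
  IsIso.of_isIso_fac_left (adj.right_triangle_components A)

lemma isIso_counit_app_of_section {A : H} (s : A ⟶ L.obj (G.obj A))
    (hs : s ≫ adj.counit.app A = 𝟙 A) : IsIso (adj.counit.app A) := by
  refine ⟨s, ?_, hs⟩
  -- The other composite is an endomorphism of `L.obj (G.obj A)`, so it can be checked on
  -- transposes. There `G.map s` is the inverse of the invertible map `G.map (adj.counit.app A)`.
  apply (adj.homEquiv _ _).injective
  have h : G.map (s ≫ adj.counit.app A) = G.map (𝟙 A) := by rw [hs]
  rw [Functor.map_comp, ← IsIso.eq_comp_inv] at h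
  rw [adj.homEquiv_unit, adj.homEquiv_unit, Functor.map_comp, h]
  simp

end Colocal

/-! ### The projection formula for bilocalizations -/

section UnitAction

lemma map_ε_comp_unitAction {C : Type u₁} [Category.{v₁} C] [MonoidalCategory C]
    {D : Type u₂} [Category.{v₂} D] [ModelCategory D] [MonoidalCategory D] [SymmetricCategory D]
    [MonoidalClosed D] [MonoidalModelCategory D] (F : C ⥤ D) [F.LaxMonoidal] (X : C) :
    ((derivedTensor D).map ((γ D).map (Functor.LaxMonoidal.ε F))).app ((γ D).obj (F.obj X)) ≫
      unitAction F X =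
    ((derivedTensorCounit D).app (𝟙_ D)).app (F.obj X) ≫ (γ D).map (λ_ (F.obj X)).hom := by
  have h := NatTrans.congr_app ((derivedTensorCounit D).naturality (Functor.LaxMonoidal.ε F))
    (F.obj X)
  dsimp at h
  rw [unitAction, reassoc_of% h, ← Functor.map_comp, Functor.LaxMonoidal.left_unitality]

end UnitAction

section Functors

variable {C : Type u₁} [Category.{v₁} C] [ModelCategory C]
  {D : Type u₂} [Category.{v₂} D] [ModelCategory D]
  [MonoidalCategory C] [SymmetricCategory C] [MonoidalClosed C] [MonoidalModelCategory C]

attribute [instance] BousfieldBilocalization.full_lowerStar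
  BousfieldBilocalization.faithful_lowerStar HomotopicallySymmetricMonoidal.isIso_derivedμ

section LaxMonoidal

variable [MonoidalCategory D] [SymmetricCategory D] [MonoidalClosed D] [MonoidalModelCategory D]

lemma derivedμ_naturality_right (F : C ⥤ D) [Homotopical F] [F.LaxMonoidal] (X : Ho C)
    {Y Y' : Ho C} (f : Y ⟶ Y') :
    ((derivedTensor D).obj ((mapHo F).obj X)).map ((mapHo F).map f) ≫ derivedμ F X Y' =
      derivedμ F X Y ≫ (mapHo F).map (((derivedTensor C).obj X).map f) :=
  ((Localization.lift₂NatTrans (γc C) (γc C) (weakEquivalences (CofibrantObject C))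
    (weakEquivalences (CofibrantObject C)) _ _
    ((((Functor.whiskeringLeft₂ (Ho D)).obj (mapHo F)).obj (mapHo F)).obj (derivedTensor D))
    (derivedTensor C ⋙ (Functor.whiskeringRight _ _ _).obj (mapHo F))
    (cofibrantμ F)).app X).naturality f

variable (F : C ⥤ D) [Homotopical F] [F.LaxBraided] [HomotopicallySymmetricMonoidal F]

instance : IsIso ((γ D).map (Functor.LaxMonoidal.ε F)) := by
  have := HomotopicallySymmetricMonoidal.weakEquivalence_ε (F := F)
  exact isIso_γ_map _

/-- Precomposition with the invertible unit map of `F` turns the action into the derived left unitor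
of `F.obj X`. -/
instance (X : C) : IsIso (unitAction F X) := by
  have h := map_ε_comp_unitAction F X
  exact IsIso.of_isIso_fac_left h

end LaxMonoidal

variable {F : C ⥤ D} [Homotopical F]

namespace BousfieldBilocalization

variable (B : BousfieldBilocalization F)

/-- Tensoring with `F_* (F V)` in the homotopy category, where `V` is the unit object. -/
abbrev tensorCoreflection : Ho C ⥤ Ho C := (derivedTensor C).obj (B.coreflection (𝟙_ C))

/-- `F_* (F V) ⊗ V` is isomorphic to `F_* (F V)`. -/
def tensorCoreflectionUnitIso :
    B.tensorCoreflection.obj ((γ C).obj (𝟙_ C)) ≅ B.coreflection (𝟙_ C) :=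
  let e := (γ C).objObjPreimageIso (B.coreflection (𝟙_ C))
  ((derivedTensor C).mapIso e.symm).app _ ≪≫
    asIso (((derivedTensorCounit C).app ((γ C).objPreimage (B.coreflection (𝟙_ C)))).app (𝟙_ C)) ≪≫
    (γ C).mapIso (ρ_ _) ≪≫ e

instance : IsIso (B.adj.counit.app (B.tensorCoreflection.obj ((γ C).obj (𝟙_ C)))) :=
  isIso_counit_app_of_iso B.adj B.tensorCoreflectionUnitIso.symm

/-- The coreflections of `F_* (F V) ⊗ X` are epimorphisms. -/
lemma epi_counit_app (hV : Generates ({𝟙_ C} : Set C)) (X : Ho C) :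
    Epi (B.adj.counit.app (B.tensorCoreflection.obj X)) where
  left_cancellation {Y} a b h := by
    apply tensorHo_hom_ext hV
    intro f
    -- As the source of this map is colocal, naturality of the counit factors it through the counit
    -- at its target.
    have hf : B.tensorCoreflection.map f =
        inv (B.adj.counit.app _) ≫ B.lowerStar.map ((mapHo F).map (B.tensorCoreflection.map f)) ≫
          B.adj.counit.app (B.tensorCoreflection.obj X) := by
      rw [IsIso.eq_inv_comp]
      exact (B.adj.counit.naturality _).symm
    change B.tensorCoreflection.map f ≫ a = B.tensorCoreflection.map f ≫ b
    rw [hf, Category.assoc, Category.assoc, Category.assoc, Category.assoc, h]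

lemma isIso_counit_app [HasZeroObject C] (hV : Generates ({𝟙_ C} : Set C)) (hC : IsStable C)
    (X : Ho C) : IsIso (B.adj.counit.app (B.tensorCoreflection.obj X)) := by
  have := B.epi_counit_app hV X
  obtain ⟨s, hs⟩ := exists_section_of_epi hC (B.adj.counit.app (B.tensorCoreflection.obj X))
  exact isIso_counit_app_of_section B.adj s hs

instance (X : C) : IsIso ((mapHo F).map (B.counit X)) := by
  dsimp only [counit]
  rw [Functor.map_comp]
  infer_instance

variable [MonoidalCategory D] [SymmetricCategory D] [MonoidalClosed D] [MonoidalModelCategory D]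
  [F.LaxBraided] [HomotopicallySymmetricMonoidal F]

/-- `F (F_* (F V) ⊗ X)` is isomorphic to `F X`. -/
def mapHoTensorCoreflectionIso (X : C) :
    (mapHo F).obj (B.tensorCoreflection.obj ((γ C).obj X)) ≅ (γ D).obj (F.obj X) :=
  (asIso (derivedμ F (B.coreflection (𝟙_ C)) ((γ C).obj X))).symm ≪≫
    ((derivedTensor D).mapIso (asIso (B.adj.unit.app ((γ D).obj (F.obj (𝟙_ C)))))).symm.app _ ≪≫
    ((derivedTensor D).obj _).mapIso ((mapHoIso F).app X) ≪≫ asIso (unitAction F X)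

/-- Precomposed with the unit this is the transpose of `B.nabla X Y`, a composite of unit maps and
`derivedμ`, all invertible. -/
instance (X Y : Ho D) : IsIso ((mapHo F).map (B.nabla X Y)) := by
  have h : B.adj.unit.app _ ≫ (mapHo F).map (B.nabla X Y) = _ :=
    (B.adj.homEquiv_unit _ _ _).symm.trans ((B.adj.homEquiv _ _).apply_symm_apply _)
  exact IsIso.of_isIso_fac_left h

/-- `derivedμ` identifies this map with the tensor product of an identity and the image of the
counit under `mapHo F`, which is invertible. -/
instance (X : C) : IsIso ((mapHo F).map (B.tensorCoreflection.map (B.counit X))) := by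
  have h := derivedμ_naturality_right F (B.coreflection (𝟙_ C)) (B.counit X)
  exact IsIso.of_isIso_fac_left h.symm

lemma isContractible_iff [HasZeroObject C] [HasZeroObject D]
    (hV : Generates ({𝟙_ C} : Set C)) (X : C) :
    IsContractible ((γ D).obj (F.obj X)) ↔
      IsContractible (tensorHo (B.coreflection (𝟙_ C)) ((γ C).obj X)) := by
  let T := B.tensorCoreflection.obj ((γ C).obj X)
  constructor
  · intro h
    have h₁ : IsContractible (B.lowerStar.obj ((mapHo F).obj T)) := by
      have := B.adj.leftAdjoint_preservesColimits
      exact isContractible_of_isInitial (((isInitialZeroHo D).ofIso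
        (h.some.symm ≪≫ (B.mapHoTensorCoreflectionIso X).symm)).isInitialObj B.lowerStar _)
    have := B.epi_counit_app hV ((γ C).obj X)
    exact h₁.of_epi (B.adj.counit.app T)
  · intro h
    have := B.adjShriek.leftAdjoint_preservesColimits
    exact (isContractible_of_isInitial (((isInitialZeroHo C).ofIso
      h.some.symm).isInitialObj (mapHo F) _)).of_iso (B.mapHoTensorCoreflectionIso X)

end BousfieldBilocalization

end Functors

end

end Bilocalization

open Bilocalization
theorem proposition4p5
    {M : Type u₁} [Category.{v₁} M] [ModelCategory M] [MonoidalCategory M] [SymmetricCategory M]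
    [MonoidalClosed M] [MonoidalModelCategory M] [HasZeroObject M]
    {N : Type u₂} [Category.{v₂} N] [ModelCategory N] [MonoidalCategory N] [SymmetricCategory N]
    [MonoidalClosed N] [MonoidalModelCategory N] [HasZeroObject N]
    (hV : Generates ({𝟙_ M} : Set M))
    (F : M ⥤ N) [Homotopical F] [F.LaxBraided] [HomotopicallySymmetricMonoidal F]
    (B : BousfieldBilocalization F) :
    -- `F X` is contractible iff the derived tensor product `F_* (F V) ⊗ X` is
    (∀ X : M, IsContractible ((γ N).obj (F.obj X)) ↔
      IsContractible (tensorHo (B.coreflection (𝟙_ M)) ((γ M).obj X))) ∧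
    -- the zig-zag `F_* (F X) ⟵ F_* (F V ⊗ F X) ⟶ F_* (F V) ⊗ F_* (F X) ⟶ F_* (F V) ⊗ X`
    (IsStable M → ∀ X : M,
      IsIso (B.lowerStar.map (unitAction F X)) ∧
      IsIso (B.nabla ((γ N).obj (F.obj (𝟙_ M))) ((γ N).obj (F.obj X))) ∧
      IsIso (((derivedTensor M).obj (B.coreflection (𝟙_ M))).map (B.counit X))) := by
  refine ⟨B.isContractible_iff hV, fun hM X ↦ ⟨inferInstance, ?_, ?_⟩⟩
  -- The source is a value of `B.lowerStar`, hence colocal; only the target needs stability.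
  · have := B.isIso_counit_app hV hM (B.coreflection X)
    exact isIso_of_isIso_map B.adj _
  · have := B.isIso_counit_app hV hM (B.coreflection X)
    have := B.isIso_counit_app hV hM ((γ M).obj X)
    exact isIso_of_isIso_map B.adj (B.tensorCoreflection.map (B.counit X))
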